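/- Let $L_p$ be the space of real $2\pi$-periodic functions with norm $\|\varphi\|_p=\big(\int_0^{2\pi}|\varphi(t)|^p\,dt\big)^{1/p}$ and let $\|f\|_C=\max_t|f(t)|$ for continuous $2\pi$-periodic $f$. For $\alpha>0$, $0<r<1$, $\beta\in\mathbb{R}$ let $C^{\alpha,r}_{\beta,2}$ be the set of all $2\pi$-periodic functions $f$ that can be represented, for all $x\in\mathbb{R}$, in the form $$f(x)=\frac{a_0}{2}+\frac1\pi\int_{-\pi}^{\pi}P_{\alpha,r,\beta}(x-t)\varphi(t)\,dt,\qquad P_{\alpha,r,\beta}(t)=\sum_{k=1}^{\infty}e^{-\alpha k^r}\cos\Big(kt-\frac{\beta\pi}{2}\Big),$$ with $a_0\in\mathbb{R}$, $\varphi\in L_2$, $\|\varphi\|_2\le1$ and $\int_{-\pi}^{\pi}\varphi(t)\,dt=0$. Let $$\mathcal{E}_n(C^{\alpha,r}_{\beta,2})_C=\sup_{f\in C^{\alpha,r}_{\beta,2}}\|f-S_{n-1}(f)\|_C,$$ where $S_{n-1}(f)$ is the partial Fourier sum of $f$ of order $n-1$, and let $n_0(\alpha,r,2)$ be the smallest positive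 integer $n$ such that $$\frac{1}{\alpha r}\frac{1}{n^r}+\frac{2\alpha r}{n^{1-r}}\le\frac{1}{2(3\pi)^3}.$$ **Corollary 1.** Let $0<r<1$, $\alpha>0$ and $\beta\in\mathbb{R}$. Then for every integer $n\ge n_0(\alpha,r,2)$ $$\mathcal{E}_n(C^{\alpha,r}_{\beta,2})_C=\frac{e^{-\alpha n^r}}{\sqrt{2\pi\alpha r}}\,n^{\frac{1-r}{2}}\bigg(1+\gamma_n\Big(\frac{1}{\alpha r}\frac{1}{n^r}+\frac{\sqrt{\alpha r}}{n^{\frac{1-r}{2}}}\Big)\bigg),$$ where the quantity $\gamma_n=\gamma_n(\alpha,r,\beta)$ satisfies $|\gamma_n|\le392\,\pi^{5/2}$. -/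

import Mathlib

namespace GenPoisson

open Real MeasureTheory

noncomputable section

/-- The generalized Poisson kernel
`P_{α,r,β}(t) = ∑_{k ≥ 1} exp (-α k ^ r) cos (k t - β π / 2)`. -/
def kernel (α r β t : ℝ) : ℝ :=
  ∑' k : ℕ, exp (-α * ((k + 1 : ℕ) : ℝ) ^ r) * cos (((k + 1 : ℕ) : ℝ) * t - β * π / 2)

/-- The set `B_p^0` of real `2π`-periodic functions `φ ∈ L_p` with `‖φ‖_p ≤ 1` and `φ ⊥ 1`, where
`‖·‖_p` is the (unnormalized) `L_p` norm over one period. -/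
def unitBall (p : ENNReal) : Set (ℝ → ℝ) :=
  {φ | Function.Periodic φ (2 * π) ∧
    MemLp φ p (volume.restrict (Set.Ioc (-π) π)) ∧
    eLpNorm φ p (volume.restrict (Set.Ioc (-π) π)) ≤ 1 ∧
    ∫ t in (-π)..π, φ t = 0}

/-- The class `C^{α,r}_{β,p}` of generalized Poisson integrals. -/
def poissonClass (α r β : ℝ) (p : ENNReal) : Set (ℝ → ℝ) :=
  {f | Function.Periodic f (2 * π) ∧ ∃ a₀ : ℝ, ∃ φ ∈ unitBall p, ∀ x : ℝ,
    f x = a₀ / 2 + 1 / π * ∫ t in (-π)..π, kernel α r β (x - t) * φ t}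

/-- The cosine Fourier coefficient `a_k(f)`. -/
def cosCoeff (f : ℝ → ℝ) (k : ℕ) : ℝ := 1 / π * ∫ t in (-π)..π, f t * cos (k * t)

/-- The sine Fourier coefficient `b_k(f)`. -/
def sinCoeff (f : ℝ → ℝ) (k : ℕ) : ℝ := 1 / π * ∫ t in (-π)..π, f t * sin (k * t)

/-- The partial Fourier sum `S_m(f; x)` of order `m`. -/
def fourierSum (f : ℝ → ℝ) (m : ℕ) (x : ℝ) : ℝ :=
  cosCoeff f 0 / 2 +
    ∑ k ∈ Finset.Icc 1 m, (cosCoeff f k * cos (k * x) + sinCoeff f k * sin (k * x))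

/-- The uniform norm `‖g‖_C = sup_x |g x|`, with values in the extended reals. -/
def uniformNorm (g : ℝ → ℝ) : EReal := ⨆ x : ℝ, ((|g x| : ℝ) : EReal)

/-- The quantity `𝓔_n(C^{α,r}_{β,p})_C = sup_f ‖f - S_{n-1}(f)‖_C`, for `n ≥ 1`, with values in the
extended reals (so that no boundedness is presupposed). -/
def fourierError (α r β : ℝ) (p : ENNReal) (n : ℕ) : EReal :=
  ⨆ f ∈ poissonClass α r β p, uniformNorm (fun x => f x - fourierSum f (n - 1) x)

/-- `χ(p) = p` for finite `p`, and `χ(∞) = 1`. -/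
def chi (p : ENNReal) : ℝ := if p = ⊤ then 1 else p.toReal

/-- The right-hand side of the inequality that defines `n₀(α, r, p)`. -/
def thresholdBound (p : ENNReal) : ℝ :=
  if p = 1 then 1 / 14
  else if p = ⊤ then 1 / (3 * π) ^ 3
  else 1 / (3 * π) ^ 3 * ((p.toReal - 1) / p.toReal)

/-- The positive integers `n` with `1 / (α r n ^ r) + α r χ(p) / n ^ (1 - r) ≤ thresholdBound p`. -/
def thresholdSet (α r : ℝ) (p : ENNReal) : Set ℕ :=
  {n | 1 ≤ n ∧
    1 / (α * r) * (1 / (n : ℝ) ^ r) + α * r * chi p / (n : ℝ) ^ (1 - r) ≤ thresholdBound p}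

/-- The number `n₀(α, r, p)`: the least element of `thresholdSet α r p`. -/
def n₀ (α r : ℝ) (p : ENNReal) : ℕ := sInf (thresholdSet α r p)

/-- `n₀` really is a least element: the set in its definition is not empty. -/
theorem isLeast_n₀ {α r : ℝ} {p : ENNReal} (hr0 : 0 < r) (hr1 : r < 1)
    (hp : 1 ≤ p) : IsLeast (thresholdSet α r p) (n₀ α r p) := by
  have hb : 0 < thresholdBound p := by
    unfold thresholdBound
    split_ifs with h1 h2
    · norm_num
    · positivity
    · have : 1 < p.toReal := by
        have h : (1 : ENNReal) < p := lt_of_le_of_ne hp (Ne.symm h1)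
        simpa using (ENNReal.toReal_lt_toReal (by simp) h2).2 h
      have h' : 0 < p.toReal - 1 := by linarith
      positivity
  have hne : (thresholdSet α r p).Nonempty := by
    have h1 : Filter.Tendsto (fun n : ℕ => 1 / (α * r) * (1 / (n : ℝ) ^ r)
        + α * r * chi p / (n : ℝ) ^ (1 - r)) Filter.atTop (nhds (1 / (α * r) * 0 + 0)) := by
      refine Filter.Tendsto.add (Filter.Tendsto.const_mul _ ?_) ?_
      · exact Filter.Tendsto.const_div_atTop
          ((tendsto_rpow_atTop hr0).comp tendsto_natCast_atTop_atTop) _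
      · exact Filter.Tendsto.const_div_atTop
          ((tendsto_rpow_atTop (by linarith : 0 < 1 - r)).comp tendsto_natCast_atTop_atTop) _
    rw [mul_zero, add_zero] at h1
    obtain ⟨n, hn, hn'⟩ :=
      ((h1.eventually (ge_mem_nhds hb)).and (Filter.eventually_ge_atTop 1)).exists
    exact ⟨n, hn', hn⟩
  exact ⟨Nat.sInf_mem hne, fun m hm => Nat.sInf_le hm⟩

end

end GenPoisson

/-!
Subtracting a Fourier sum commutes with convolution, so for `f = a₀ / 2 + (1 / π) (K * φ)` the
deviation `f - S_{n-1} f` is `(1 / π) ((K - S_{n-1} K) * φ)`. Over the unit ball of `L₂` the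
Cauchy–Schwarz inequality bounds it by `(1 / π) ‖K - S_{n-1} K‖₂`, and `φ` proportional to the
reflection of `K - S_{n-1} K`, which has mean zero, attains this bound at the origin. For the
generalized Poisson kernel Parseval's identity turns the error into
`√((1 / π) ∑_{k ≥ n} exp (-2 α k ^ r))`. The leading term `exp (-a t ^ r) t ^ (1 - r) / (a r)` of
the integral of `exp (-a x ^ r)` over `[t, ∞)` has derivative
`-exp (-a t ^ r) (1 - (1 - r) / (a r t ^ r))`; telescoping its increments bounds the sum from both
sides, up to the relative errors `1 / (α r n ^ r)` and `α r / n ^ (1 - r)`.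
-/

namespace GenPoisson

open Real MeasureTheory Filter Topology

section Periodic

theorem neg_pi_le_pi : -π ≤ π := neg_le_self pi_pos.le

theorem integral_comp_sub_right_of_periodic {f : ℝ → ℝ} (hf : Function.Periodic f (2 * π))
    (x : ℝ) : ∫ t in (-π)..π, f (t - x) = ∫ t in (-π)..π, f t := by
  rw [intervalIntegral.integral_comp_sub_right]
  convert hf.intervalIntegral_add_eq (-π - x) (-π) using 2 <;> ring

theorem integral_comp_sub_left_of_periodic {f : ℝ → ℝ} (hf : Function.Periodic f (2 * π))
    (x : ℝ) : ∫ t in (-π)..π, f (x - t) = ∫ t in (-π)..π, f t := by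
  rw [intervalIntegral.integral_comp_sub_left]
  convert hf.intervalIntegral_add_eq (x - π) (-π) using 2 <;> ring

end Periodic

section Orthogonality

theorem integral_cos_int_mul_sub {m : ℤ} (hm : m ≠ 0) (c : ℝ) :
    ∫ t in (-π)..π, cos (m * t - c) = 0 := by
  rw [intervalIntegral.integral_comp_mul_sub cos (Int.cast_ne_zero.2 hm), integral_cos,
    ← sin_add_int_mul_two_pi (m * -π - c) m, show m * -π - c + m * (2 * π) = m * π - c by ring,
    sub_self, smul_zero]

theorem integral_cos_mul_cos {j : ℕ} (hj : j ≠ 0) (k : ℕ) (a b : ℝ) :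
    ∫ t in (-π)..π, cos (j * t - a) * cos (k * t - b) = if j = k then π * cos (a - b) else 0 := by
  have hprod (t : ℝ) : cos (j * t - a) * cos (k * t - b) =
      2⁻¹ * (cos (((j - k : ℤ) : ℝ) * t - (a - b)) + cos (((j + k : ℤ) : ℝ) * t - (a + b))) := by
    have := two_mul_cos_mul_cos (j * t - a) (k * t - b)
    push_cast
    ring_nf at this ⊢
    linarith
  simp_rw [hprod]
  rw [intervalIntegral.integral_const_mul, intervalIntegral.integral_add
    (Continuous.intervalIntegrable (by fun_prop) _ _)
    (Continuous.intervalIntegrable (by fun_prop) _ _),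
    integral_cos_int_mul_sub (m := j + k) (by omega), add_zero]
  split_ifs with h
  · subst h
    simp only [sub_self, Int.cast_zero, zero_mul, zero_sub, cos_neg,
      intervalIntegral.integral_const, smul_eq_mul]
    ring
  · rw [integral_cos_int_mul_sub (m := j - k) (by omega), mul_zero]

end Orthogonality

section FourierSum

theorem harmonic_eq_integral {f : ℝ → ℝ} (hf : IntervalIntegrable f volume (-π) π) (k : ℕ)
    (x : ℝ) : cosCoeff f k * cos (k * x) + sinCoeff f k * sin (k * x) =
      1 / π * ∫ t in (-π)..π, f t * cos (k * t - k * x) := by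
  simp only [cos_sub, mul_add, ← mul_assoc, cosCoeff, sinCoeff]
  rw [intervalIntegral.integral_add
    ((hf.mul_continuousOn (by fun_prop)).mul_const _)
    ((hf.mul_continuousOn (by fun_prop)).mul_const _),
    intervalIntegral.integral_mul_const, intervalIntegral.integral_mul_const]
  ring

/-- The Dirichlet kernel `1/2 + ∑_{k ≤ m} cos (k t)`, normalized to have integral `π` over a
period; `fourierSum · m` is the convolution with it, divided by `π`. -/
noncomputable def dirichletKernel (m : ℕ) (t : ℝ) : ℝ := 1 / 2 + ∑ k ∈ Finset.Icc 1 m, cos (k * t)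

theorem continuous_dirichletKernel (m : ℕ) : Continuous (dirichletKernel m) := by
  unfold dirichletKernel
  fun_prop

theorem periodic_dirichletKernel (m : ℕ) : Function.Periodic (dirichletKernel m) (2 * π) :=
  fun t => by simp only [dirichletKernel, mul_add, cos_add_nat_mul_two_pi]

theorem integral_dirichletKernel (m : ℕ) : ∫ t in (-π)..π, dirichletKernel m t = π := by
  have hcos (k : ℕ) (hk : k ∈ Finset.Icc 1 m) : ∫ t in (-π)..π, cos (k * t) = 0 := by
    simpa using integral_cos_int_mul_sub (m := k)
      (by have := (Finset.mem_Icc.1 hk).1; omega) 0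
  unfold dirichletKernel
  rw [intervalIntegral.integral_add (by simp) (Continuous.intervalIntegrable (by fun_prop) _ _),
    intervalIntegral.integral_finsetSum
      fun k _ => Continuous.intervalIntegrable (by fun_prop) _ _,
    Finset.sum_eq_zero hcos, intervalIntegral.integral_const, smul_eq_mul]
  ring

theorem fourierSum_eq_integral_dirichletKernel {f : ℝ → ℝ}
    (hf : IntervalIntegrable f volume (-π) π) (m : ℕ) (x : ℝ) :
    fourierSum f m x = 1 / π * ∫ t in (-π)..π, dirichletKernel m (x - t) * f t := by
  have hterm (k : ℕ) : IntervalIntegrable (fun t => f t * cos (k * t - k * x)) volume (-π) π :=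
    hf.mul_continuousOn (by fun_prop)
  have hexpand (t : ℝ) : dirichletKernel m (x - t) * f t =
      1 / 2 * f t + ∑ k ∈ Finset.Icc 1 m, f t * cos (k * t - k * x) := by
    simp only [dirichletKernel, add_mul, Finset.sum_mul]
    congr 1
    refine Finset.sum_congr rfl fun k _ => ?_
    rw [← cos_neg, mul_comm]
    ring_nf
  simp only [fourierSum, harmonic_eq_integral hf, hexpand]
  rw [intervalIntegral.integral_add (hf.const_mul _)
      (by simpa only [Finset.sum_fn] using IntervalIntegrable.sum _ fun k _ => hterm k),
    intervalIntegral.integral_finsetSum fun k _ => hterm k,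
    intervalIntegral.integral_const_mul, mul_add, Finset.mul_sum]
  congr 1
  simp only [cosCoeff, Nat.cast_zero, zero_mul, cos_zero, mul_one]
  ring

theorem fourierSum_const_add_mul {g : ℝ → ℝ} (hg : IntervalIntegrable g volume (-π) π)
    (a b : ℝ) (m : ℕ) (x : ℝ) :
    fourierSum (fun y => a + b * g y) m x = a + b * fourierSum g m x := by
  have hD : Continuous fun t => dirichletKernel m (x - t) :=
    (continuous_dirichletKernel m).comp (by fun_prop)
  rw [fourierSum_eq_integral_dirichletKernel hg,
    fourierSum_eq_integral_dirichletKernel (intervalIntegrable_const.add (hg.const_mul b))]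
  simp only [mul_add, mul_left_comm _ b]
  rw [intervalIntegral.integral_add ((hD.intervalIntegrable _ _).mul_const a)
    ((hg.continuousOn_mul hD.continuousOn).const_mul b),
    intervalIntegral.integral_mul_const, intervalIntegral.integral_const_mul,
    integral_comp_sub_left_of_periodic (periodic_dirichletKernel m), integral_dirichletKernel]
  field_simp

theorem continuous_fourierSum (f : ℝ → ℝ) (m : ℕ) : Continuous (fourierSum f m) := by
  unfold fourierSum
  fun_prop

theorem periodic_fourierSum (f : ℝ → ℝ) (m : ℕ) : Function.Periodic (fourierSum f m) (2 * π) :=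
  fun x => by
    simp only [fourierSum, mul_add, cos_add_nat_mul_two_pi, sin_add_nat_mul_two_pi]

theorem integral_fourierSum (f : ℝ → ℝ) (m : ℕ) :
    ∫ x in (-π)..π, fourierSum f m x = ∫ x in (-π)..π, f x := by
  have hharm (k : ℕ) (hk : k ∈ Finset.Icc 1 m) :
      ∫ x in (-π)..π, (cosCoeff f k * cos (k * x) + sinCoeff f k * sin (k * x)) = 0 := by
    have hk0 : (k : ℤ) ≠ 0 := by have := (Finset.mem_Icc.1 hk).1; omega
    have hcos := integral_cos_int_mul_sub hk0 0
    have hsin := integral_cos_int_mul_sub hk0 (π / 2)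
    simp only [sub_zero, cos_sub_pi_div_two, Int.cast_natCast] at hcos hsin
    rw [intervalIntegral.integral_add (Continuous.intervalIntegrable (by fun_prop) _ _)
      (Continuous.intervalIntegrable (by fun_prop) _ _), intervalIntegral.integral_const_mul,
      intervalIntegral.integral_const_mul, hcos, hsin, mul_zero, mul_zero, add_zero]
  unfold fourierSum
  rw [intervalIntegral.integral_add (by simp) (Continuous.intervalIntegrable (by fun_prop) _ _),
    intervalIntegral.integral_finsetSum
      fun k _ => Continuous.intervalIntegrable (by fun_prop) _ _,
    Finset.sum_eq_zero hharm, intervalIntegral.integral_const]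
  simp only [cosCoeff, Nat.cast_zero, zero_mul, cos_zero, mul_one, smul_eq_mul, add_zero]
  field_simp
  ring

theorem fourierSum_comp_sub_right {K : ℝ → ℝ} (hK : Continuous K)
    (hKp : Function.Periodic K (2 * π)) (m : ℕ) (x t : ℝ) :
    fourierSum (fun s => K (s - t)) m x = fourierSum K m (x - t) := by
  have hper : Function.Periodic (fun s => dirichletKernel m (x - t - s) * K s) (2 * π) :=
    fun s => by
      simp only [hKp s, ← sub_sub, (periodic_dirichletKernel m).sub_eq]
  have hKt : Continuous fun s => K (s - t) := by fun_prop
  rw [fourierSum_eq_integral_dirichletKernel (hK.intervalIntegrable _ _),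
    fourierSum_eq_integral_dirichletKernel (hKt.intervalIntegrable _ _),
    ← integral_comp_sub_right_of_periodic hper t]
  simp only [sub_sub_sub_cancel_right]

end FourierSum

section Convolution

variable {K φ : ℝ → ℝ}

theorem integrable_prod_mul_comp_sub (hK : Continuous K) (hKp : Function.Periodic K (2 * π))
    (hφ : IntervalIntegrable φ volume (-π) π) :
    Integrable (fun z : ℝ × ℝ => K (z.1 - z.2) * φ z.2)
      ((volume.restrict (Set.Ioc (-π) π)).prod (volume.restrict (Set.Ioc (-π) π))) := by
  obtain ⟨C, hC⟩ := isBounded_iff_forall_norm_le.1 (hKp.isBounded_of_continuous (by positivity) hK)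
  exact (hφ.1.comp_snd _).bdd_mul (by fun_prop)
    (Eventually.of_forall fun z => hC _ (Set.mem_range_self _))

theorem intervalIntegrable_convolution (hK : Continuous K) (hKp : Function.Periodic K (2 * π))
    (hφ : IntervalIntegrable φ volume (-π) π) :
    IntervalIntegrable (fun x => ∫ t in (-π)..π, K (x - t) * φ t) volume (-π) π := by
  rw [intervalIntegrable_iff_integrableOn_Ioc_of_le neg_pi_le_pi]
  simp only [intervalIntegral.integral_of_le neg_pi_le_pi]
  exact (integrable_prod_mul_comp_sub hK hKp hφ).integral_prod_left

theorem fourierSum_convolution (hK : Continuous K) (hKp : Function.Periodic K (2 * π))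
    (hφ : IntervalIntegrable φ volume (-π) π) (m : ℕ) (x : ℝ) :
    fourierSum (fun y => ∫ t in (-π)..π, K (y - t) * φ t) m x =
      ∫ t in (-π)..π, fourierSum K m (x - t) * φ t := by
  have hD : Continuous fun s => dirichletKernel m (x - s) :=
    (continuous_dirichletKernel m).comp (by fun_prop)
  obtain ⟨C, hC⟩ := isBounded_iff_forall_norm_le.1
    ((periodic_dirichletKernel m).isBounded_of_continuous (by positivity)
      (continuous_dirichletKernel m))
  have hint : IntegrableOn
      (Function.uncurry fun s t => dirichletKernel m (x - s) * (K (s - t) * φ t))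
      (Set.uIoc (-π) π ×ˢ Set.uIoc (-π) π) := by
    rw [IntegrableOn, Measure.volume_eq_prod, ← Measure.prod_restrict,
      Set.uIoc_of_le neg_pi_le_pi]
    exact (integrable_prod_mul_comp_sub hK hKp hφ).bdd_mul
      (hD.comp continuous_fst).aestronglyMeasurable
      (Eventually.of_forall fun z => hC _ (Set.mem_range_self _))
  calc fourierSum (fun y => ∫ t in (-π)..π, K (y - t) * φ t) m x
      = 1 / π * ∫ s in (-π)..π, ∫ t in (-π)..π,
          dirichletKernel m (x - s) * (K (s - t) * φ t) := by
        rw [fourierSum_eq_integral_dirichletKernel (intervalIntegrable_convolution hK hKp hφ)]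
        simp only [intervalIntegral.integral_const_mul]
    _ = 1 / π * ∫ t in (-π)..π, ∫ s in (-π)..π,
          dirichletKernel m (x - s) * (K (s - t) * φ t) := by
        rw [intervalIntegral_intervalIntegral_swap hint]
    _ = ∫ t in (-π)..π, fourierSum (fun s => K (s - t)) m x * φ t := by
        rw [← intervalIntegral.integral_const_mul]
        refine intervalIntegral.integral_congr fun t _ => ?_
        have hKt : Continuous fun s => K (s - t) := by fun_prop
        rw [fourierSum_eq_integral_dirichletKernel (hKt.intervalIntegrable _ _)]
        simp only [← mul_assoc, intervalIntegral.integral_mul_const]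
    _ = ∫ t in (-π)..π, fourierSum K m (x - t) * φ t := by
        simp only [fourierSum_comp_sub_right hK hKp]

theorem sub_fourierSum_of_eq_const_add_mul_convolution (hK : Continuous K)
    (hKp : Function.Periodic K (2 * π)) (hφ : IntervalIntegrable φ volume (-π) π) {f : ℝ → ℝ}
    {a b : ℝ} (hf : ∀ x, f x = a + b * ∫ t in (-π)..π, K (x - t) * φ t) (m : ℕ) (x : ℝ) :
    f x - fourierSum f m x =
      b * ∫ t in (-π)..π, (K (x - t) - fourierSum K m (x - t)) * φ t := by
  have hint {L : ℝ → ℝ} (hL : Continuous L) :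
      IntervalIntegrable (fun t => L (x - t) * φ t) volume (-π) π :=
    hφ.continuousOn_mul (hL.comp (by fun_prop)).continuousOn
  rw [funext hf, fourierSum_const_add_mul (intervalIntegrable_convolution hK hKp hφ),
    fourierSum_convolution hK hKp hφ]
  simp only [sub_mul]
  rw [intervalIntegral.integral_sub (hint hK) (hint (continuous_fourierSum K m))]
  ring

end Convolution

section Duality

theorem abs_integral_mul_le_sqrt_mul_sqrt {Ω : Type*} [MeasurableSpace Ω] {μ : Measure Ω}
    {f g : Ω → ℝ} (hf : MemLp f 2 μ) (hg : MemLp g 2 μ) :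
    |∫ x, f x * g x ∂μ| ≤ √(∫ x, f x ^ 2 ∂μ) * √(∫ x, g x ^ 2 ∂μ) := by
  have h2 : ENNReal.ofReal 2 = 2 := by norm_num
  have hHolder := integral_mul_norm_le_Lp_mul_Lq HolderConjugate.two_two (h2 ▸ hf) (h2 ▸ hg)
  simp only [norm_eq_abs, rpow_two, sq_abs, ← sqrt_eq_rpow] at hHolder
  refine abs_integral_le_integral_abs.trans ?_
  simpa only [abs_mul] using hHolder

theorem eLpNorm_two_le_one_iff {Ω : Type*} [MeasurableSpace Ω] {μ : Measure Ω} {f : Ω → ℝ}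
    (hf : MemLp f 2 μ) : eLpNorm f 2 μ ≤ 1 ↔ ∫ x, f x ^ 2 ∂μ ≤ 1 := by
  rw [hf.eLpNorm_eq_integral_rpow_norm two_ne_zero ENNReal.ofNat_ne_top, ENNReal.ofReal_le_one]
  simp only [ENNReal.toReal_ofNat, rpow_two, norm_eq_abs, sq_abs]
  rw [← one_div, ← sqrt_eq_rpow, sqrt_le_one]

variable {T φ : ℝ → ℝ}

theorem memLp_two_Ioc_of_continuous (hT : Continuous T) (a b : ℝ) :
    MemLp T 2 (volume.restrict (Set.Ioc a b)) :=
  (memLp_two_iff_integrable_sq hT.aestronglyMeasurable).2 (hT.pow 2).integrableOn_Ioc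

theorem intervalIntegrable_of_mem_unitBall {p : ENNReal} (hp : 1 ≤ p) (hφ : φ ∈ unitBall p) :
    IntervalIntegrable φ volume (-π) π :=
  (intervalIntegrable_iff_integrableOn_Ioc_of_le neg_pi_le_pi).2 (hφ.2.1.integrable hp)

theorem abs_integral_mul_le_of_mem_unitBall (hφ : φ ∈ unitBall 2) (hT : Continuous T) :
    |∫ t in (-π)..π, T t * φ t| ≤ √(∫ t in (-π)..π, T t ^ 2) := by
  obtain ⟨-, hφ2, hφ1, -⟩ := hφ
  simp only [intervalIntegral.integral_of_le neg_pi_le_pi]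
  exact (abs_integral_mul_le_sqrt_mul_sqrt (memLp_two_Ioc_of_continuous hT _ _) hφ2).trans
    (mul_le_of_le_one_right (sqrt_nonneg _) (sqrt_le_one.2 ((eLpNorm_two_le_one_iff hφ2).1 hφ1)))

theorem exists_mem_unitBall_integral_mul_eq (hT : Continuous T)
    (hTp : Function.Periodic T (2 * π)) (hT0 : ∫ t in (-π)..π, T t = 0) :
    ∃ φ ∈ unitBall 2, ∫ t in (-π)..π, T t * φ t = √(∫ t in (-π)..π, T t ^ 2) := by
  set N := √(∫ t in (-π)..π, T t ^ 2)
  have hN2 : ∫ t in (-π)..π, T t ^ 2 = N ^ 2 :=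
    (sq_sqrt (intervalIntegral.integral_nonneg neg_pi_le_pi fun t _ => sq_nonneg _)).symm
  have hφ2 := memLp_two_Ioc_of_continuous (hT.div_const N) (-π) π
  -- If `N = 0` then `φ = T / N` is `0` by the convention `x / 0 = 0`.
  refine ⟨fun t => T t / N, ⟨fun t => by simp only [hTp t], hφ2,
    (eLpNorm_two_le_one_iff hφ2).2 ?_, ?_⟩, ?_⟩
  · simp only [div_pow]
    rw [← intervalIntegral.integral_of_le neg_pi_le_pi, intervalIntegral.integral_div, hN2]
    exact div_self_le_one _
  · rw [intervalIntegral.integral_div, hT0, zero_div]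
  · simp only [mul_div_assoc', ← sq]
    rw [intervalIntegral.integral_div, hN2, sq, mul_self_div_self]

end Duality

section ConvolutionClass

/-- The class of convolutions `a₀ / 2 + (1 / π) (K * φ)`, `φ ∈ B_p^0`, with a fixed kernel `K`;
`poissonClass α r β p` is the case `K = kernel α r β`. -/
def convolutionClass (K : ℝ → ℝ) (p : ENNReal) : Set (ℝ → ℝ) :=
  {f | Function.Periodic f (2 * π) ∧ ∃ a₀ : ℝ, ∃ φ ∈ unitBall p, ∀ x : ℝ,
    f x = a₀ / 2 + 1 / π * ∫ t in (-π)..π, K (x - t) * φ t}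

variable {K : ℝ → ℝ}

theorem uniformNorm_sub_fourierSum_le (hK : Continuous K) (hKp : Function.Periodic K (2 * π))
    {f : ℝ → ℝ} (hf : f ∈ convolutionClass K 2) (m : ℕ) :
    uniformNorm (fun x => f x - fourierSum f m x) ≤
      ((1 / π * √(∫ t in (-π)..π, (K t - fourierSum K m t) ^ 2) : ℝ) : EReal) := by
  obtain ⟨-, a₀, φ, hφ, hf⟩ := hf
  refine iSup_le fun x => EReal.coe_le_coe_iff.2 ?_
  have hT : Continuous fun t => K t - fourierSum K m t := hK.sub (continuous_fourierSum K m)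
  have hTp : Function.Periodic (fun t => (K t - fourierSum K m t) ^ 2) (2 * π) := fun t => by
    simp only [hKp t, periodic_fourierSum K m t]
  calc |f x - fourierSum f m x|
      = 1 / π * |∫ t in (-π)..π, (K (x - t) - fourierSum K m (x - t)) * φ t| := by
        rw [sub_fourierSum_of_eq_const_add_mul_convolution hK hKp
          (intervalIntegrable_of_mem_unitBall one_le_two hφ) hf, abs_mul,
          abs_of_pos (by positivity)]
    _ ≤ 1 / π * √(∫ t in (-π)..π, (K (x - t) - fourierSum K m (x - t)) ^ 2) := by
        gcongr
        exact abs_integral_mul_le_of_mem_unitBall hφ (hT.comp (continuous_sub_left x))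
    _ = 1 / π * √(∫ t in (-π)..π, (K t - fourierSum K m t) ^ 2) := by
        rw [integral_comp_sub_left_of_periodic hTp x]

theorem exists_le_uniformNorm_sub_fourierSum (hK : Continuous K)
    (hKp : Function.Periodic K (2 * π)) (m : ℕ) :
    ∃ f ∈ convolutionClass K 2,
      ((1 / π * √(∫ t in (-π)..π, (K t - fourierSum K m t) ^ 2) : ℝ) : EReal) ≤
        uniformNorm (fun x => f x - fourierSum f m x) := by
  set T : ℝ → ℝ := fun t => K t - fourierSum K m t with hT_def
  have hT : Continuous T := hK.sub (continuous_fourierSum K m)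
  have hTp : Function.Periodic T (2 * π) := fun t => by
    simp only [hT_def, hKp t, periodic_fourierSum K m t]
  have hT0 : ∫ t in (-π)..π, T t = 0 := by
    rw [hT_def, intervalIntegral.integral_sub (hK.intervalIntegrable _ _)
      ((continuous_fourierSum K m).intervalIntegrable _ _), integral_fourierSum, sub_self]
  have hTp' : Function.Periodic (fun t => T (0 - t)) (2 * π) := fun t => by
    simp only [← sub_sub, hTp.sub_eq]
  have hTsq : ∫ t in (-π)..π, T (0 - t) ^ 2 = ∫ t in (-π)..π, T t ^ 2 :=
    integral_comp_sub_left_of_periodic (hTp.comp (· ^ 2)) 0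
  obtain ⟨φ, hφ, hTφ⟩ := exists_mem_unitBall_integral_mul_eq (hT.comp (continuous_sub_left 0))
    hTp' ((integral_comp_sub_left_of_periodic hTp 0).trans hT0)
  set f : ℝ → ℝ := fun x => 0 / 2 + 1 / π * ∫ t in (-π)..π, K (x - t) * φ t with hf_def
  have hf : f ∈ convolutionClass K 2 :=
    ⟨fun x => by simp only [hf_def, add_sub_right_comm x, hKp _], 0, φ, hφ, fun x => rfl⟩
  refine ⟨f, hf, le_iSup_of_le 0 (EReal.coe_le_coe_iff.2 ?_)⟩
  calc 1 / π * √(∫ t in (-π)..π, T t ^ 2)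
      = 1 / π * √(∫ t in (-π)..π, T (0 - t) ^ 2) := by
        rw [hTsq]
    _ = f 0 - fourierSum f m 0 := by
        rw [sub_fourierSum_of_eq_const_add_mul_convolution hK hKp
          (intervalIntegrable_of_mem_unitBall one_le_two hφ) fun x => rfl]
        exact congrArg _ hTφ.symm
    _ ≤ |f 0 - fourierSum f m 0| := le_abs_self _

theorem iSup_uniformNorm_sub_fourierSum_eq (hK : Continuous K)
    (hKp : Function.Periodic K (2 * π)) (m : ℕ) :
    ⨆ f ∈ convolutionClass K 2, uniformNorm (fun x => f x - fourierSum f m x) =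
      ((1 / π * √(∫ t in (-π)..π, (K t - fourierSum K m t) ^ 2) : ℝ) : EReal) := by
  obtain ⟨f, hf, hle⟩ := exists_le_uniformNorm_sub_fourierSum hK hKp m
  exact le_antisymm (iSup₂_le fun f hf => uniformNorm_sub_fourierSum_le hK hKp hf m)
    (le_iSup₂_of_le f hf hle)

end ConvolutionClass

section TrigTail

/-- The tail `∑_{k ≥ n} w k cos (k t - θ k)` of the trigonometric series with amplitudes `w` and
phases `θ`. The kernel `kernel α r β` is the tail from `1` with `w k = exp (-α k ^ r)` and constant
phase `β π / 2`, and subtracting a Fourier sum from such a kernel leaves a later tail. -/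
noncomputable def trigTail (w θ : ℕ → ℝ) (n : ℕ) (t : ℝ) : ℝ :=
  ∑' k : ℕ, w (k + n) * cos (((k + n : ℕ) : ℝ) * t - θ (k + n))

variable {w : ℕ → ℝ} {θ : ℕ → ℝ} {n : ℕ}

theorem norm_mul_cos_le (a x : ℝ) : ‖a * cos x‖ ≤ |a| := by
  rw [norm_mul, norm_eq_abs, norm_eq_abs]
  exact mul_le_of_le_one_right (abs_nonneg _) (abs_cos_le_one _)

theorem continuous_trigTail (hw : Summable w) : Continuous (trigTail w θ n) :=
  continuous_tsum (fun k => by fun_prop) ((summable_nat_add_iff n).2 hw.abs)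
    fun _ _ => norm_mul_cos_le _ _

theorem periodic_trigTail (w θ : ℕ → ℝ) (n : ℕ) :
    Function.Periodic (trigTail w θ n) (2 * π) := fun t => by
  simp only [trigTail, mul_add, add_sub_right_comm, cos_add_nat_mul_two_pi]

theorem hasSum_integral_trigTail_mul (hw : Summable w) {g : ℝ → ℝ} (hg : Continuous g) :
    HasSum (fun k : ℕ => w (k + n) *
        ∫ t in (-π)..π, cos (((k + n : ℕ) : ℝ) * t - θ (k + n)) * g t)
      (∫ t in (-π)..π, trigTail w θ n t * g t) := by
  have hwn := (summable_nat_add_iff n).2 hw.abs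
  simp only [← intervalIntegral.integral_const_mul, ← mul_assoc]
  refine intervalIntegral.hasSum_integral_of_dominated_convergence
    (fun k t => |w (k + n)| * |g t|) (fun k => by fun_prop)
    (fun k => Eventually.of_forall fun t _ => ?_)
    (Eventually.of_forall fun t _ => hwn.mul_right _) ?_
    (Eventually.of_forall fun t _ => ?_)
  · rw [norm_mul, norm_eq_abs (g t)]
    gcongr
    exact norm_mul_cos_le _ _
  · simp only [tsum_mul_right]
    exact (hg.abs.intervalIntegrable _ _).const_mul _
  · exact (Summable.of_norm_bounded hwn fun _ => norm_mul_cos_le _ _).hasSum.mul_right _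

theorem integral_trigTail_mul_cos (hw : Summable w) (hn : n ≠ 0) (j : ℕ) (b : ℝ) :
    ∫ t in (-π)..π, trigTail w θ n t * cos (j * t - b) =
      if n ≤ j then π * (w j * cos (θ j - b)) else 0 := by
  have hterm (k : ℕ) := integral_cos_mul_cos (j := k + n) (by omega) j (θ (k + n)) b
  rw [← (hasSum_integral_trigTail_mul hw (by fun_prop)).tsum_eq]
  simp only [hterm]
  split_ifs with h
  · rw [tsum_eq_single (j - n) fun k hk => by rw [if_neg (by omega), mul_zero],
      Nat.sub_add_cancel h, if_pos rfl, mul_left_comm]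
  · have hne (k : ℕ) : k + n ≠ j := by omega
    simp only [if_neg (hne _), mul_zero, tsum_zero]

theorem integral_trigTail_sq (hw : Summable w) (hn : n ≠ 0) :
    ∫ t in (-π)..π, trigTail w θ n t ^ 2 = π * ∑' k : ℕ, w (k + n) ^ 2 := by
  have hterm (k : ℕ) : w (k + n) * ∫ t in (-π)..π,
      cos (((k + n : ℕ) : ℝ) * t - θ (k + n)) * trigTail w θ n t = π * w (k + n) ^ 2 := by
    simp only [mul_comm (cos _)]
    rw [integral_trigTail_mul_cos hw hn, if_pos (Nat.le_add_left n k), sub_self, cos_zero]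
    ring
  simp only [sq (trigTail w θ n _),
    ← (hasSum_integral_trigTail_mul hw (continuous_trigTail hw)).tsum_eq, hterm, tsum_mul_left]

theorem fourierSum_trigTail_one (hw : Summable w) (m : ℕ) (x : ℝ) :
    fourierSum (trigTail w θ 1) m x = ∑ k ∈ Finset.Icc 1 m, w k * cos (k * x - θ k) := by
  have hmean : cosCoeff (trigTail w θ 1) 0 = 0 := by
    simpa [cosCoeff] using integral_trigTail_mul_cos (θ := θ) hw one_ne_zero 0 0
  rw [fourierSum, hmean, zero_div, zero_add]
  refine Finset.sum_congr rfl fun k hk => ?_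
  rw [harmonic_eq_integral ((continuous_trigTail hw).intervalIntegrable _ _),
    integral_trigTail_mul_cos hw one_ne_zero, if_pos (Finset.mem_Icc.1 hk).1, ← cos_neg]
  field_simp
  ring_nf

theorem trigTail_one_sub_fourierSum (hw : Summable w) (m : ℕ) (x : ℝ) :
    trigTail w θ 1 x - fourierSum (trigTail w θ 1) m x = trigTail w θ (m + 1) x := by
  have hsummable : Summable fun k : ℕ =>
      w (k + 1) * cos (((k + 1 : ℕ) : ℝ) * x - θ (k + 1)) :=
    .of_norm_bounded ((summable_nat_add_iff 1).2 hw.abs) fun _ => norm_mul_cos_le _ _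
  rw [fourierSum_trigTail_one hw, sub_eq_iff_eq_add', trigTail, trigTail,
    ← hsummable.sum_add_tsum_nat_add m, Finset.range_eq_Ico,
    Finset.sum_Ico_add' (fun k : ℕ => w k * cos (k * x - θ k))]
  rfl

theorem iSup_uniformNorm_sub_fourierSum_trigTail_one (hw : Summable w) (m : ℕ) :
    ⨆ f ∈ convolutionClass (trigTail w θ 1) 2, uniformNorm (fun x => f x - fourierSum f m x) =
      ((√(1 / π * ∑' k : ℕ, w (k + (m + 1)) ^ 2) : ℝ) : EReal) := by
  rw [iSup_uniformNorm_sub_fourierSum_eq (continuous_trigTail hw) (periodic_trigTail w θ 1)]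
  simp only [trigTail_one_sub_fourierSum hw]
  rw [integral_trigTail_sq hw m.add_one_ne_zero, ← sqrt_sq (by positivity : 0 ≤ 1 / π),
    ← sqrt_mul (sq_nonneg _), sqrt_sq (by positivity)]
  congr 2
  field_simp

end TrigTail

section Tail

theorem summable_exp_neg_mul_rpow {a r : ℝ} (ha : 0 < a) (hr : 0 < r) :
    Summable fun k : ℕ => exp (-a * (k : ℝ) ^ r) := by
  have htendsto : Tendsto (fun k : ℕ => ((k : ℝ) ^ r) ^ (2 / r) * exp (-a * (k : ℝ) ^ r))
      atTop (𝓝 0) :=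
    (tendsto_rpow_mul_exp_neg_mul_atTop_nhds_zero (2 / r) a ha).comp
      ((tendsto_rpow_atTop hr).comp tendsto_natCast_atTop_atTop)
  refine summable_of_isBigO_nat (summable_one_div_nat_pow.2 one_lt_two)
    (Asymptotics.IsBigO.of_bound 1 ?_)
  filter_upwards [htendsto.eventually (ge_mem_nhds zero_lt_one), eventually_gt_atTop 0]
    with k hk hk0
  have hk0' : (0 : ℝ) < k := by exact_mod_cast hk0
  rw [← rpow_mul hk0'.le, mul_div_cancel₀ _ hr.ne', rpow_two] at hk
  rw [norm_of_nonneg (exp_pos _).le, norm_of_nonneg (by positivity), one_mul,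
    le_div_iff₀ (by positivity)]
  linarith

theorem tendsto_sum_range_sub_succ {G : ℕ → ℝ} (hG : Tendsto G atTop (𝓝 0)) :
    Tendsto (fun m => ∑ i ∈ Finset.range m, (G i - G (i + 1))) atTop (𝓝 (G 0)) := by
  simpa only [Finset.sum_range_sub', sub_zero] using hG.const_sub (G 0)

theorem le_tsum_of_sub_succ_le {G g : ℕ → ℝ} (hG : Tendsto G atTop (𝓝 0)) (hg : Summable g)
    (h : ∀ i, G i - G (i + 1) ≤ g i) : G 0 ≤ ∑' i, g i :=
  le_of_tendsto_of_tendsto' (tendsto_sum_range_sub_succ hG) hg.hasSum.tendsto_sum_nat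
    fun _ => Finset.sum_le_sum fun i _ => h i

theorem tsum_le_of_le_sub_succ {G g : ℕ → ℝ} (hG : Tendsto G atTop (𝓝 0)) (hg : Summable g)
    (h : ∀ i, g i ≤ G i - G (i + 1)) : ∑' i, g i ≤ G 0 :=
  le_of_tendsto_of_tendsto' hg.hasSum.tendsto_sum_nat (tendsto_sum_range_sub_succ hG)
    fun _ => Finset.sum_le_sum fun i _ => h i

/-- The leading term, as `t → ∞`, of the integral of `exp (-a x ^ r)` over `[t, ∞)`; its
increments are compared with the terms of `∑ exp (-a k ^ r)`. -/
noncomputable def tailMain (a r t : ℝ) : ℝ := exp (-a * t ^ r) * t ^ (1 - r) / (a * r)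

variable {a r : ℝ}

theorem tendsto_tailMain (ha : 0 < a) (hr : 0 < r) : Tendsto (tailMain a r) atTop (𝓝 0) := by
  have h := ((tendsto_rpow_mul_exp_neg_mul_atTop_nhds_zero ((1 - r) / r) a ha).comp
    (tendsto_rpow_atTop hr)).div_const (a * r)
  rw [zero_div] at h
  refine h.congr' ?_
  filter_upwards [eventually_gt_atTop 0] with t ht
  simp only [Function.comp, tailMain]
  rw [← rpow_mul ht.le, mul_div_cancel₀ _ hr.ne', mul_comm]

theorem hasDerivAt_tailMain {t : ℝ} (ha : a ≠ 0) (hr : r ≠ 0) (ht : 0 < t) :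
    HasDerivAt (tailMain a r) (-(exp (-a * t ^ r) * (1 - (1 - r) / (a * r * t ^ r)))) t := by
  have hpow (s : ℝ) : HasDerivAt (fun t : ℝ => t ^ s) (s * t ^ (s - 1)) t :=
    hasDerivAt_rpow_const (Or.inl ht.ne')
  refine ((((hpow r).const_mul (-a)).exp.mul (hpow (1 - r))).div_const (a * r)).congr_deriv ?_
  have : 0 < t ^ r := by positivity
  rw [rpow_sub_one ht.ne', rpow_sub_one ht.ne', rpow_sub ht, rpow_one]
  field_simp
  ring

theorem exists_tailMain_sub_eq {t : ℝ} (ha : a ≠ 0) (hr : r ≠ 0) (ht : 0 < t) :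
    ∃ c ∈ Set.Ioo t (t + 1), tailMain a r t - tailMain a r (t + 1) =
      exp (-a * c ^ r) * (1 - (1 - r) / (a * r * c ^ r)) := by
  have hderiv : ∀ x ∈ Set.Icc t (t + 1), HasDerivAt (tailMain a r) _ x :=
    fun x hx => hasDerivAt_tailMain ha hr (ht.trans_le hx.1)
  obtain ⟨c, hc, h⟩ := exists_hasDerivAt_eq_slope (tailMain a r) _ (lt_add_one t)
    (fun x hx => (hderiv x hx).continuousAt.continuousWithinAt)
    (fun x hx => hderiv x (Set.Ioo_subset_Icc_self hx))
  rw [add_sub_cancel_left, div_one] at h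
  exact ⟨c, hc, by linarith⟩

theorem antitoneOn_exp_neg_mul_rpow (ha : 0 ≤ a) (hr : 0 ≤ r) :
    AntitoneOn (fun t => exp (-a * t ^ r)) (Set.Ici 0) := fun s hs t _ hst => by
  have : s ^ r ≤ t ^ r := rpow_le_rpow hs hst hr
  exact exp_le_exp.2 (by nlinarith)

theorem tailMain_sub_le (ha : 0 < a) (hr : 0 < r) (hr1 : r ≤ 1) {t : ℝ} (ht : 0 < t) :
    tailMain a r t - tailMain a r (t + 1) ≤ exp (-a * t ^ r) := by
  obtain ⟨c, ⟨hc, -⟩, h⟩ := exists_tailMain_sub_eq ha.ne' hr.ne' ht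
  have hc0 : 0 < c := ht.trans hc
  have : 0 ≤ 1 - r := sub_nonneg.2 hr1
  calc tailMain a r t - tailMain a r (t + 1)
      ≤ exp (-a * c ^ r) := by
        rw [h]
        exact mul_le_of_le_one_right (exp_pos _).le (sub_le_self _ (by positivity))
    _ ≤ exp (-a * t ^ r) := antitoneOn_exp_neg_mul_rpow ha.le hr.le ht.le hc0.le hc.le

theorem mul_exp_le_tailMain_sub (ha : 0 < a) (hr : 0 < r) (hr1 : r ≤ 1) {s t : ℝ} (hs : 0 < s)
    (hs1 : 1 - r ≤ a * r * s ^ r) (hst : s ≤ t) :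
    (1 - (1 - r) / (a * r * s ^ r)) * exp (-a * (t + 1) ^ r) ≤
      tailMain a r t - tailMain a r (t + 1) := by
  have ht : 0 < t := hs.trans_le hst
  obtain ⟨c, ⟨hc, hc1⟩, h⟩ := exists_tailMain_sub_eq ha.ne' hr.ne' ht
  have hc0 : 0 < c := ht.trans hc
  have : 0 ≤ 1 - r := sub_nonneg.2 hr1
  have hpow : s ^ r ≤ c ^ r := rpow_le_rpow hs.le (hst.trans hc.le) hr.le
  have hfactor : 0 ≤ 1 - (1 - r) / (a * r * s ^ r) :=
    sub_nonneg.2 ((div_le_one (by positivity)).2 hs1)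
  rw [h, mul_comm]
  gcongr ?_ * (1 - (1 - r) / (a * r * ?_))
  exact antitoneOn_exp_neg_mul_rpow ha.le hr.le hc0.le (hc0.trans hc1).le hc1.le

theorem tailMain_le_tsum (ha : 0 < a) (hr : 0 < r) (hr1 : r ≤ 1) {n : ℕ} (hn : 0 < n) :
    tailMain a r n ≤ ∑' k : ℕ, exp (-a * ((k + n : ℕ) : ℝ) ^ r) := by
  have hG : Tendsto (fun k : ℕ => tailMain a r ((k + n : ℕ) : ℝ)) atTop (𝓝 0) :=
    (tendsto_tailMain ha hr).comp
      (tendsto_natCast_atTop_atTop.comp (tendsto_add_atTop_nat n))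
  have hle (k : ℕ) : tailMain a r ((k + n : ℕ) : ℝ) - tailMain a r ((k + 1 + n : ℕ) : ℝ) ≤
      exp (-a * ((k + n : ℕ) : ℝ) ^ r) := by
    rw [add_right_comm, Nat.cast_add_one (k + n)]
    exact tailMain_sub_le ha hr hr1 (by exact_mod_cast Nat.add_pos_right k hn)
  simpa only [zero_add] using
    le_tsum_of_sub_succ_le hG ((summable_nat_add_iff n).2 (summable_exp_neg_mul_rpow ha hr)) hle

theorem tsum_le_exp_add_tailMain (ha : 0 < a) (hr : 0 < r) (hr1 : r ≤ 1) {n : ℕ} (hn : 0 < n)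
    (hn1 : 1 - r < a * r * (n : ℝ) ^ r) :
    ∑' k : ℕ, exp (-a * ((k + n : ℕ) : ℝ) ^ r) ≤
      exp (-a * (n : ℝ) ^ r) + tailMain a r n / (1 - (1 - r) / (a * r * (n : ℝ) ^ r)) := by
  set q := 1 - (1 - r) / (a * r * (n : ℝ) ^ r)
  have hn0 : (0 : ℝ) < n := by exact_mod_cast hn
  have hq : 0 < q := sub_pos.2 ((div_lt_one (by positivity)).2 hn1)
  have hg (m : ℕ) := (summable_nat_add_iff m).2 (summable_exp_neg_mul_rpow ha hr)
  have hG : Tendsto (fun k : ℕ => tailMain a r ((k + n : ℕ) : ℝ) / q) atTop (𝓝 0) := by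
    simpa only [zero_div, Function.comp_def] using ((tendsto_tailMain ha hr).comp
      (tendsto_natCast_atTop_atTop.comp (tendsto_add_atTop_nat n))).div_const q
  have hle (k : ℕ) : exp (-a * ((k + (n + 1) : ℕ) : ℝ) ^ r) ≤
      tailMain a r ((k + n : ℕ) : ℝ) / q - tailMain a r ((k + 1 + n : ℕ) : ℝ) / q := by
    rw [add_right_comm k 1 n, ← add_assoc, Nat.cast_add_one (k + n), ← sub_div,
      le_div_iff₀ hq, mul_comm]
    exact mul_exp_le_tailMain_sub ha hr hr1 hn0 hn1.le (by exact_mod_cast Nat.le_add_left n k)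
  have htail := tsum_le_of_le_sub_succ hG (hg (n + 1)) hle
  rw [(hg n).tsum_eq_zero_add]
  simp only [zero_add] at htail ⊢
  simp only [add_right_comm _ 1 n]
  simpa only [← add_assoc] using add_le_add_right htail (exp (-a * (n : ℝ) ^ r))

end Tail

section MainTerm

/-- The main term `e^{-α n^r} n^{(1-r)/2} / √(2παr)` of the asymptotic formula for
the approximation error, as a function of a real variable `t` in place of `n`. -/
noncomputable def errorMain (α r t : ℝ) : ℝ :=
  exp (-α * t ^ r) / √(2 * π * α * r) * t ^ ((1 - r) / 2)

variable {α r t : ℝ}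

theorem rpow_half_sq (ht : 0 ≤ t) (s : ℝ) : (t ^ (s / 2)) ^ 2 = t ^ s := by
  rw [← rpow_mul_natCast ht, Nat.cast_ofNat, div_mul_cancel₀ _ two_ne_zero]

theorem errorMain_sq (hα : 0 < α) (hr : 0 < r) (ht : 0 ≤ t) :
    errorMain α r t ^ 2 = 1 / π * tailMain (2 * α) r t := by
  rw [errorMain, tailMain, mul_pow, div_pow, rpow_half_sq ht, sq_sqrt (by positivity),
    ← exp_nat_mul, Nat.cast_ofNat, show 2 * (-α * t ^ r) = -(2 * α) * t ^ r by ring]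
  field_simp

theorem exp_eq_mul_tailMain (hα : 0 < α) (hr : 0 < r) (ht : 0 < t) :
    exp (-(2 * α) * t ^ r) =
      (√2 * (√(α * r) / t ^ ((1 - r) / 2))) ^ 2 * tailMain (2 * α) r t := by
  rw [tailMain, mul_pow, div_pow, rpow_half_sq ht.le, sq_sqrt zero_le_two,
    sq_sqrt (by positivity)]
  field_simp

theorem inv_one_sub_le {d δ : ℝ} (hδ0 : 0 ≤ δ) (hδ1 : δ ≤ 1) (hd : d ≤ δ / 2) :
    (1 - d)⁻¹ ≤ (1 + δ) ^ 2 := by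
  rw [inv_le_iff_one_le_mul₀ (by linarith)]
  calc (1 : ℝ) ≤ (1 + δ) ^ 2 * (1 - δ / 2) := by
        nlinarith [mul_le_mul_of_nonneg_left hδ1 hδ0, mul_le_mul_of_nonneg_left hδ1 (sq_nonneg δ)]
    _ ≤ (1 + δ) ^ 2 * (1 - d) := by gcongr

theorem tsum_le_tailMain_mul (hα : 0 < α) (hr : 0 < r) (hr1 : r ≤ 1) {n : ℕ} (hn : 0 < n)
    (hαn : 1 ≤ α * r * (n : ℝ) ^ r) :
    ∑' k : ℕ, exp (-(2 * α) * ((k + n : ℕ) : ℝ) ^ r) ≤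
      tailMain (2 * α) r n * (1 + (1 / (α * r) * (1 / (n : ℝ) ^ r) +
        √2 * (√(α * r) / (n : ℝ) ^ ((1 - r) / 2)))) ^ 2 := by
  have hn0 : (0 : ℝ) < n := by exact_mod_cast hn
  set M := tailMain (2 * α) r n with hM
  set δ := 1 / (α * r) * (1 / (n : ℝ) ^ r) with hδ
  set u := √2 * (√(α * r) / (n : ℝ) ^ ((1 - r) / 2)) with hu
  have hM0 : 0 ≤ M := by rw [hM, tailMain]; positivity
  have hδ0 : 0 ≤ δ := by positivity
  have hu0 : 0 ≤ u := by positivity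
  have hδ1 : δ ≤ 1 := by
    rw [hδ, one_div_mul_one_div]
    exact (div_le_one (by positivity)).2 hαn
  have hd : (1 - r) / (2 * α * r * (n : ℝ) ^ r) ≤ δ / 2 := by
    calc (1 - r) / (2 * α * r * (n : ℝ) ^ r) ≤ 1 / (2 * α * r * (n : ℝ) ^ r) := by
          gcongr; linarith
      _ = δ / 2 := by rw [hδ]; field_simp
  calc ∑' k : ℕ, exp (-(2 * α) * ((k + n : ℕ) : ℝ) ^ r)
      ≤ exp (-(2 * α) * (n : ℝ) ^ r) + M / (1 - (1 - r) / (2 * α * r * (n : ℝ) ^ r)) :=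
        tsum_le_exp_add_tailMain (by positivity) hr hr1 hn (by linarith)
    _ ≤ u ^ 2 * M + M * (1 + δ) ^ 2 := by
        rw [exp_eq_mul_tailMain hα hr hn0, ← hu, ← hM, div_eq_mul_inv]
        gcongr u ^ 2 * M + M * ?_
        exact inv_one_sub_le hδ0 hδ1 hd
    _ ≤ M * (1 + (δ + u)) ^ 2 := by
        nlinarith [mul_nonneg hM0 (mul_nonneg (add_nonneg zero_le_one hδ0) hu0)]

theorem errorMain_le_sqrt_tsum (hα : 0 < α) (hr : 0 < r) (hr1 : r ≤ 1) {n : ℕ} (hn : 0 < n) :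
    errorMain α r n ≤ √(1 / π * ∑' k : ℕ, exp (-(2 * α) * ((k + n : ℕ) : ℝ) ^ r)) := by
  apply le_sqrt_of_sq_le
  rw [errorMain_sq hα hr n.cast_nonneg]
  gcongr
  exact tailMain_le_tsum (by positivity) hr hr1 hn

theorem sqrt_tsum_le_errorMain_mul (hα : 0 < α) (hr : 0 < r) (hr1 : r ≤ 1) {n : ℕ} (hn : 0 < n)
    (hαn : 1 ≤ α * r * (n : ℝ) ^ r) :
    √(1 / π * ∑' k : ℕ, exp (-(2 * α) * ((k + n : ℕ) : ℝ) ^ r)) ≤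
      errorMain α r n * (1 + (1 / (α * r) * (1 / (n : ℝ) ^ r) +
        √2 * (√(α * r) / (n : ℝ) ^ ((1 - r) / 2)))) := by
  refine sqrt_le_iff.2 ⟨by unfold errorMain; positivity, ?_⟩
  rw [mul_pow, errorMain_sq hα hr n.cast_nonneg, mul_assoc]
  gcongr
  exact tsum_le_tailMain_mul hα hr hr1 hn hαn

theorem exists_eq_mul_one_add_mul {M C ε x : ℝ} (hM : 0 < M) (hε : 0 < ε) (hx : M ≤ x)
    (hx' : x ≤ M * (1 + C * ε)) : ∃ γ ∈ Set.Icc 0 C, x = M * (1 + γ * ε) := by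
  refine ⟨(x - M) / (M * ε), ⟨div_nonneg (sub_nonneg.2 hx) (by positivity), ?_⟩, ?_⟩
  · rw [div_le_iff₀ (by positivity)]
    linarith
  · field_simp
    ring

theorem exists_sqrt_tsum_eq (hα : 0 < α) (hr : 0 < r) (hr1 : r ≤ 1) {n : ℕ} (hn : 0 < n)
    (hαn : 1 ≤ α * r * (n : ℝ) ^ r) :
    ∃ γ ∈ Set.Icc 0 √2, √(1 / π * ∑' k : ℕ, exp (-(2 * α) * ((k + n : ℕ) : ℝ) ^ r)) =
      errorMain α r n * (1 + γ * (1 / (α * r) * (1 / (n : ℝ) ^ r) +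
        √(α * r) / (n : ℝ) ^ ((1 - r) / 2))) := by
  have : (0 : ℝ) < n := by exact_mod_cast hn
  refine exists_eq_mul_one_add_mul (by unfold errorMain; positivity) (by positivity)
    (errorMain_le_sqrt_tsum hα hr hr1 hn)
    ((sqrt_tsum_le_errorMain_mul hα hr hr1 hn hαn).trans ?_)
  rw [mul_add √2]
  have : 0 ≤ errorMain α r n := by unfold errorMain; positivity
  gcongr errorMain α r n * (1 + (?_ + _))
  exact le_mul_of_one_le_left (by positivity) (one_le_sqrt.2 one_le_two)

end MainTerm

section Threshold

theorem thresholdBound_le_one (p : ENNReal) : thresholdBound p ≤ 1 := by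
  have hpi : 1 / (3 * π) ^ 3 ≤ 1 :=
    (div_le_one (by positivity)).2 (one_le_pow₀ (by linarith [pi_gt_three]))
  unfold thresholdBound
  split_ifs
  · norm_num
  · exact hpi
  · exact (mul_le_mul_of_nonneg_left
      (div_le_one_of_le₀ (sub_le_self _ zero_le_one) ENNReal.toReal_nonneg)
      (by positivity)).trans ((mul_one _).trans_le hpi)

theorem one_le_mul_rpow_of_n₀_le {α r : ℝ} {p : ENNReal} (hα : 0 < α) (hr0 : 0 < r)
    (hr1 : r < 1) (hp : 1 ≤ p) {n : ℕ} (hn : n₀ α r p ≤ n) : 1 ≤ α * r * (n : ℝ) ^ r := by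
  obtain ⟨hpos, hle⟩ := (isLeast_n₀ (α := α) hr0 hr1 hp).1
  have : (0 : ℝ) < n₀ α r p := by exact_mod_cast hpos
  have hchi : 0 ≤ chi p := by unfold chi; split_ifs <;> positivity
  have hfirst : 1 / (α * r) * (1 / (n₀ α r p : ℝ) ^ r) ≤ 1 :=
    (le_add_of_nonneg_right (by positivity)).trans (hle.trans (thresholdBound_le_one p))
  rw [one_div_mul_one_div, div_le_one (by positivity)] at hfirst
  exact hfirst.trans (by gcongr)

end Threshold

theorem sqrt_two_le_mul_pi_rpow : √2 ≤ 392 * π ^ ((5 : ℝ) / 2) := by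
  calc √2 ≤ 392 * 1 := (sqrt_le_left (by norm_num)).2 (by norm_num)
    _ ≤ 392 * π ^ ((5 : ℝ) / 2) := by
      gcongr
      exact one_le_rpow (by linarith [pi_gt_three]) (by norm_num)

theorem fourierError_two_eq {α r : ℝ} (β : ℝ) (hα : 0 < α) (hr : 0 < r) {n : ℕ} (hn : 0 < n) :
    fourierError α r β 2 n =
      ((√(1 / π * ∑' k : ℕ, exp (-(2 * α) * ((k + n : ℕ) : ℝ) ^ r)) : ℝ) : EReal) := by
  refine (iSup_uniformNorm_sub_fourierSum_trigTail_one (θ := fun _ => β * π / 2)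
    (summable_exp_neg_mul_rpow hα hr) (n - 1)).trans ?_
  simp only [Nat.sub_add_cancel hn, ← exp_nat_mul, Nat.cast_ofNat, ← mul_assoc, mul_neg]

end GenPoisson

theorem corollary1_general (α r β : ℝ) (hα : 0 < α) (hr0 : 0 < r) (hr1 : r ≤ 1)
    (n : ℕ) (hn : 1 ≤ α * r * (n : ℝ) ^ r) :
    ∃ γ ∈ Set.Icc 0 (Real.sqrt 2),
      GenPoisson.fourierError α r β 2 n =
        ((Real.exp (-α * (n : ℝ) ^ r) / Real.sqrt (2 * Real.pi * α * r) *
            (n : ℝ) ^ ((1 - r) / 2) *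
          (1 + γ * (1 / (α * r) * (1 / (n : ℝ) ^ r) +
            Real.sqrt (α * r) / (n : ℝ) ^ ((1 - r) / 2))) : ℝ) : EReal) := by
  have hn0 : 0 < n := Nat.pos_of_ne_zero fun h => by
    rw [h, Nat.cast_zero, Real.zero_rpow hr0.ne', mul_zero] at hn
    exact absurd hn (by norm_num)
  obtain ⟨γ, hγ, hsqrt⟩ := GenPoisson.exists_sqrt_tsum_eq hα hr0 hr1 hn0 hn
  exact ⟨γ, hγ, by rw [GenPoisson.fourierError_two_eq β hα hr0 hn0, hsqrt, GenPoisson.errorMain]⟩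

theorem corollary1 (α r β : ℝ) (hα : 0 < α) (hr0 : 0 < r) (hr1 : r < 1)
    (n : ℕ) (hn : GenPoisson.n₀ α r 2 ≤ n) :
    ∃ γ : ℝ, |γ| ≤ 392 * Real.pi ^ ((5 : ℝ) / 2) ∧
      GenPoisson.fourierError α r β 2 n =
        ((Real.exp (-α * (n : ℝ) ^ r) / Real.sqrt (2 * Real.pi * α * r) *
            (n : ℝ) ^ ((1 - r) / 2) *
          (1 + γ * (1 / (α * r) * (1 / (n : ℝ) ^ r) +
            Real.sqrt (α * r) / (n : ℝ) ^ ((1 - r) / 2))) : ℝ) : EReal) := by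
  obtain ⟨γ, ⟨hγ0, hγ2⟩, hγ⟩ := corollary1_general α r β hα hr0 hr1.le n
    (GenPoisson.one_le_mul_rpow_of_n₀_le hα hr0 hr1 one_le_two hn)
  exact ⟨γ, (abs_of_nonneg hγ0).trans_le (hγ2.trans GenPoisson.sqrt_two_le_mul_pi_rpow), hγ⟩
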